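/- For $s>0$ let $\rho_s(x)=\exp(-\pi\|x/s\|^2)$ and $\rho=\rho_1$. Let $D_{\mathbb{R}^n}$ be the standard Gaussian, i.e. the distribution on $\mathbb{R}^n$ with density $\rho$. For a unit vector $w\in\mathbb{R}^n$ and $\beta,\gamma>0$, the homogeneous CLWE distribution $H_{w,\beta,\gamma}$ is the distribution on $\mathbb{R}^n$ with density at $y$ proportional to $\rho(y)\sum_{k\in\mathbb{Z}}\rho_\beta(k-\gamma\langle y,w\rangle)$. The average-case decision problem $\mathrm{hCLWE}_{\beta,\gamma}$ asks to decide whether the input distribution $P$ is (1) $P=H_{w,\beta,\gamma}$ for a uniformly random unit vector $w\in\mathbb{R}^n$, or (2) $P=D_{\mathbb{R}^n}$. A $\mathrm{STAT}(\tau)$ oracle for $P$ answers each query, a measurable function $f:\mathbb{R}^n\to[-1,1]$, by some number in $[\mathbb{E}_{x\sim P}f(x)-\tau,\ \mathbb{E}_{x\sim P}f(x)+\tau]$. A randomized SQ algorithm with precision $\tau$ accesses $P$ only by adaptively chosen queries to a $\mathrm{STAT}(\tau)$ oracle for $P$, and then outputs a verdict. It solves $\mathrm{hCLWE}_{\beta,\gamma}$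 with probability $\eta$ if, for all choices of $\mathrm{STAT}(\tau)$ oracles for $D_{\mathbb{R}^n}$ and for the $H_{w,\beta,\gamma}$ (not depending on the algorithm's coins), its verdict is correct with probability at least $\eta$ over a fair choice between cases (1) and (2), the random direction $w$ in case (1), and the coins of the algorithm. (This holds in particular if the verdict is correct with probability at least $\eta$ in each of the two cases.) **Theorem.** There is a universal constant $c>0$ such that the following holds for all $n\ge 1$, $\beta\in(0,1)$, $\gamma\ge\sqrt2$, $\tau\ge 4\exp(-\pi\gamma^2/4)$ and $\eta>1/2$. If a randomized SQ algorithm with precision $\tau$ solves $\mathrm{hCLWE}_{\beta,\gamma}$ in dimension $n$ with probability $\eta$ and never asks more than $q$ queries, then $$q\ \ge\ (2\eta-1)\cdot\exp(cn)\cdot\frac{\tau^2\beta^2}{4\gamma^2}.$$ -/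

import Mathlib

open MeasureTheory

noncomputable section

namespace HCLWE

/-- The space `ℝⁿ` with its Euclidean norm. -/
abbrev Space (n : ℕ) : Type := EuclideanSpace ℝ (Fin n)

/-- The set of unit vectors of `ℝⁿ`. -/
abbrev UnitSphere (n : ℕ) : Type := Metric.sphere (0 : Space n) 1

/-- The Gaussian function `ρ_s(x) = exp(-π ‖x/s‖²)`. -/
def rho {E : Type*} [NormedAddCommGroup E] [NormedSpace ℝ E] (s : ℝ) (x : E) : ℝ :=
  Real.exp (-Real.pi * ‖s⁻¹ • x‖ ^ 2)

/-- The standard Gaussian `D_{ℝⁿ}`, with density `ρ = ρ_1` (covariance `I_n / (2π)`). -/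
def stdGaussian (n : ℕ) : Measure (Space n) :=
  volume.withDensity fun y => ENNReal.ofReal (rho 1 y)

/-- The unnormalized density `ρ(y) · ∑_{k ∈ ℤ} ρ_β(k - γ ⟨y, w⟩)`. -/
def hclweWeight {n : ℕ} (w : Space n) (β γ : ℝ) (y : Space n) : ℝ :=
  rho 1 y * ∑' k : ℤ, rho β ((k : ℝ) - γ * inner ℝ y w)

/-- The measure with density `hclweWeight` with respect to Lebesgue measure. -/
def hclweUnnormalized {n : ℕ} (w : Space n) (β γ : ℝ) : Measure (Space n) :=
  volume.withDensity fun y => ENNReal.ofReal (hclweWeight w β γ y)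

/-- The homogeneous CLWE distribution `H_{w,β,γ}`: the probability measure on `ℝⁿ` whose density
is proportional to `hclweWeight w β γ`. -/
def hclwe {n : ℕ} (w : Space n) (β γ : ℝ) : Measure (Space n) :=
  (hclweUnnormalized w β γ Set.univ)⁻¹ • hclweUnnormalized w β γ

/-- The uniform probability measure on the unit sphere of `ℝⁿ` (for `n ≥ 1`). -/
def uniformSphere (n : ℕ) : Measure (UnitSphere n) :=
  ((volume : Measure (Space n)).toSphere Set.univ)⁻¹ • (volume : Measure (Space n)).toSphere

/-- A statistical query: a measurable function `X → [-1, 1]`. -/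
structure Query (X : Type*) [MeasurableSpace X] where
  toFun : X → ℝ
  measurable_toFun : Measurable toFun
  abs_le_one : ∀ x, |toFun x| ≤ 1

/-- An oracle answers every query by a real number. -/
abbrev Oracle (X : Type*) [MeasurableSpace X] : Type _ := Query X → ℝ

/-- `v` is a legal `STAT(τ)` oracle for the distribution `P`: each answer `v f` lies in
`E_{x ∼ P}[f(x)] + [-τ, τ]`. -/
def IsSTAT {X : Type*} [MeasurableSpace X] (τ : ℝ) (P : Measure X) (v : Oracle X) : Prop :=
  ∀ f : Query X, |v f - ∫ x, f.toFun x ∂P| ≤ τ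

/-- A deterministic adaptive statistical query algorithm for a decision problem: it either stops
with a verdict, or asks a query and continues in a way that depends on the answer. -/
inductive SQAlg (X : Type*) [MeasurableSpace X] : Type _
  | output (verdict : Bool) : SQAlg X
  | ask (f : Query X) (next : ℝ → SQAlg X) : SQAlg X

/-- The verdict of the algorithm when its queries are answered by `v`. -/
def SQAlg.run {X : Type*} [MeasurableSpace X] (v : Oracle X) : SQAlg X → Bool
  | .output b => b
  | .ask f next => (next (v f)).run v

/-- The number of queries that the algorithm asks when they are answered by `v`. -/
def SQAlg.numQueries {X : Type*} [MeasurableSpace X] (v : Oracle X) : SQAlg X → ℕ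
  | .output _ => 0
  | .ask f next => (next (v f)).numQueries v + 1

/-- The probability, over the coins `ω ∼ μ`, that the randomized algorithm `A` (a random
deterministic algorithm) gives the verdict `b` with the oracle `v`. Since `∫⁻` is the lower
integral, this is the inner probability should the event fail to be measurable. -/
def verdictProb {X Ω : Type*} [MeasurableSpace X] [MeasurableSpace Ω] (μ : Measure Ω)
    (A : Ω → SQAlg X) (v : Oracle X) (b : Bool) : ENNReal :=
  ∫⁻ ω, Set.indicator {ω' | (A ω').run v = b} 1 ω ∂μ

/-- The randomized algorithm `A` solves the average-case decision problem `hCLWE_{β,γ}` in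
dimension `n` with probability `η`, given access to `STAT(τ)`. The verdict `true` means "homogeneous
CLWE", `false` means "standard Gaussian". Whatever legal oracle `v₀` is used for `D_{ℝⁿ}`, and
whatever legal oracle `v w` is used for `H_{w,β,γ}` for each direction `w`, the verdict is right
with probability at least `η`, over the fair choice of one of the two cases, the uniformly random
direction `w` in the case of homogeneous CLWE, and the coins of `A`. An algorithm whose verdict is
right with probability at least `η` in each of the two cases has this property. -/
def SolvesHCLWE {n : ℕ} {Ω : Type*} [MeasurableSpace Ω] (μ : Measure Ω)
    (A : Ω → SQAlg (Space n)) (β γ τ η : ℝ) : Prop :=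
  ∀ (v₀ : Oracle (Space n)) (v : UnitSphere n → Oracle (Space n)),
    IsSTAT τ (stdGaussian n) v₀ →
    (∀ w : UnitSphere n, IsSTAT τ (hclwe (w : Space n) β γ) (v w)) →
    ENNReal.ofReal η ≤
      (verdictProb μ A v₀ false + ∫⁻ w, verdictProb μ A (v w) true ∂(uniformSphere n)) / 2

/-- On inputs of `hCLWE_{β,γ}` (that is, `D_{ℝⁿ}` or some `H_{w,β,γ}`) given through a legal
`STAT(τ)` oracle, the randomized algorithm `A` never asks more than `q` queries. -/
def AsksAtMost {n : ℕ} {Ω : Type*} (A : Ω → SQAlg (Space n)) (β γ τ : ℝ) (q : ℕ) : Prop :=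
  ∀ (ω : Ω) (v : Oracle (Space n)),
    (IsSTAT τ (stdGaussian n) v ∨ ∃ w : UnitSphere n, IsSTAT τ (hclwe (w : Space n) β γ) v) →
    (A ω).numQueries v ≤ q

end HCLWE

end

/-! By Poisson summation, the density of `H_{w,β,γ}` relative to the Gaussian is a cosine series in
`γ⟨y,w⟩` with coefficients `exp(-πβ²k²)`, up to normalization (`poisson_rho`, `integral_hclwe`).
Hence the shift that `w` causes in the expectation of a query `f` is, up to a factor at most 1, the
Gaussian inner product of `f` with the centred series `fluctSum β γ w`.

Series in two directions are nearly orthogonal. Their inner product is at most `τ²/16` when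
`|⟨w,w'⟩| ≤ 1/2`, and at most `(3/(2β))²` always (`abs_integral_fluctSum_mul_le_of_inner`,
`abs_integral_fluctSum_mul_le_of_norm`). Directions with a larger inner product lie in two caps of
exponentially small measure (`uniformSphere_abs_inner_le`). A second moment argument then shows that
one query can be shifted by more than `τ` only for an exponentially small fraction of directions
(`sum_cells_le`).

The adversarial oracle for `H_{w,β,γ}` gives the Gaussian expectation whenever this is legal. The
run then differs from the Gaussian one only if one of the at most `q` queries of the Gaussian run is
bad for `w`, and a union bound limits the advantage (`verdictProb_add_lintegral_le`).

The algorithm need not be measurable in its coins, so Fubini is not available for the pair (coins,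
direction). The sphere is therefore cut into finitely many measurable cells on which all shifts are
almost constant (`exists_sphere_cells`). Finite sums pass into a lower integral in the needed
direction. -/

namespace HCLWE

/-! ### The standard Gaussian and its Fourier transform. -/

section Gaussian

variable {n : ℕ}

theorem rho_one {E : Type*} [NormedAddCommGroup E] [NormedSpace ℝ E] (y : E) :
    rho 1 y = Real.exp (-Real.pi * ‖y‖ ^ 2) := by
  simp [rho]

theorem rho_one_pos {E : Type*} [NormedAddCommGroup E] [NormedSpace ℝ E] (y : E) :
    0 < rho 1 y := Real.exp_pos _

theorem measurable_rho_one : Measurable (rho 1 : Space n → ℝ) := by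
  have : Continuous (rho 1 : Space n → ℝ) := by unfold rho; fun_prop
  exact this.measurable

theorem integral_stdGaussian (f : Space n → ℝ) :
    ∫ y, f y ∂(stdGaussian n) = ∫ y, rho 1 y * f y := by
  rw [stdGaussian, integral_withDensity_eq_integral_toReal_smul
    measurable_rho_one.ennreal_ofReal (by simp)]
  simp [ENNReal.toReal_ofReal (rho_one_pos _).le]

theorem integrable_rho_one : Integrable (rho 1 : Space n → ℝ) := by
  have h := (GaussianFourier.integrable_cexp_neg_mul_sq_norm_add (V := Space n) (b := Real.pi)
    (by simpa using Real.pi_pos) 0 0).re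
  refine h.congr (Filter.Eventually.of_forall fun y => ?_)
  rw [rho_one]
  simp only [zero_mul, add_zero]
  norm_cast

instance isProbabilityMeasure_stdGaussian : IsProbabilityMeasure (stdGaussian n) := by
  constructor
  rw [stdGaussian, withDensity_apply _ MeasurableSet.univ, Measure.restrict_univ,
    ← ofReal_integral_eq_lintegral_ofReal integrable_rho_one
      (Filter.Eventually.of_forall fun y => (rho_one_pos y).le)]
  have := GaussianFourier.integral_rexp_neg_mul_sq_norm (V := Space n) Real.pi_pos
  simp only [rho_one, this]
  simp [Real.pi_pos.ne']

theorem integral_cos_stdGaussian (v : Space n) :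
    ∫ y, Real.cos (2 * Real.pi * inner ℝ y v) ∂(stdGaussian n)
      = Real.exp (-Real.pi * ‖v‖ ^ 2) := by
  rw [integral_stdGaussian]
  have hpi : (0 : ℝ) < ((Real.pi : ℂ)).re := by simpa using Real.pi_pos
  have h := GaussianFourier.integral_cexp_neg_mul_sq_norm_add (V := Space n) hpi
    (2 * Real.pi * Complex.I) v
  have hi := GaussianFourier.integrable_cexp_neg_mul_sq_norm_add (V := Space n) hpi
    (2 * Real.pi * Complex.I) v
  have h2 := congrArg Complex.re h
  rw [← Complex.reCLM_apply, ← ContinuousLinearMap.integral_comp_comm _ hi] at h2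
  have e1 : ∀ y : Space n, Complex.reCLM (Complex.exp (-(Real.pi : ℂ) * (‖y‖ : ℂ) ^ 2 +
      2 * Real.pi * Complex.I * (inner ℝ v y : ℝ))) =
      rho 1 y * Real.cos (2 * Real.pi * inner ℝ y v) := by
    intro y
    rw [Complex.reCLM_apply, Complex.exp_re, rho_one, real_inner_comm]
    congr 2
    · simp [← Complex.ofReal_pow]
    · simp [← Complex.ofReal_pow]
  simp only [e1] at h2
  rw [h2, div_self (by exact_mod_cast Real.pi_pos.ne'), Complex.one_cpow, one_mul]
  have : (2 * Real.pi * Complex.I) ^ 2 * (‖v‖ : ℂ) ^ 2 / (4 * Real.pi) =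
      ((-Real.pi * ‖v‖ ^ 2 : ℝ) : ℂ) := by
    have : (Real.pi : ℂ) ≠ 0 := by exact_mod_cast Real.pi_pos.ne'
    field_simp
    push_cast
    rw [Complex.I_sq]
    ring
  rw [this, Complex.exp_ofReal_re]

theorem integrable_of_bounded {f : Space n → ℝ} (hf : Measurable f) {C : ℝ}
    (h : ∀ y, |f y| ≤ C) : Integrable f (stdGaussian n) :=
  Integrable.of_bound hf.aestronglyMeasurable C (Filter.Eventually.of_forall h)

end Gaussian

/-! ### Theta-series coefficients and Poisson summation. -/

section Coefficients

/-- The Gaussian weight `exp (-π s² k²)` of the integer `k`. -/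
noncomputable def coef (s : ℝ) (k : ℤ) : ℝ := Real.exp (-Real.pi * s ^ 2 * (k : ℝ) ^ 2)

theorem coef_pos (s : ℝ) (k : ℤ) : 0 < coef s k := Real.exp_pos _

theorem coef_zero (s : ℝ) : coef s 0 = 1 := by simp [coef]

theorem coef_le_one (s : ℝ) (k : ℤ) : coef s k ≤ 1 := by
  rw [coef, Real.exp_le_one_iff]
  have : 0 ≤ Real.pi * s ^ 2 * (k : ℝ) ^ 2 := by positivity
  linarith

theorem hasSum_pow_natAbs {r : ℝ} (h0 : 0 ≤ r) (h1 : r < 1) :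
    HasSum (fun k : ℤ => r ^ k.natAbs) (1 + 2 * r / (1 - r)) := by
  have hg := hasSum_geometric_of_lt_one h0 h1
  have h2 : HasSum (fun k : ℕ => r ^ (k + 1)) (r * (1 - r)⁻¹) := by
    simpa [pow_succ'] using hg.mul_left r
  have := HasSum.of_nat_of_neg_add_one (f := fun k : ℤ => r ^ k.natAbs)
    (by simpa using hg) (by
      convert h2 using 3 with k
      omega)
  convert this using 1
  have : 1 - r ≠ 0 := by linarith
  field_simp
  ring

theorem coef_le_pow (s : ℝ) (k : ℤ) : coef s k ≤ Real.exp (-Real.pi * s ^ 2) ^ k.natAbs := by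
  rw [coef, ← Real.exp_nat_mul, Real.exp_le_exp]
  have h1 : (k.natAbs : ℝ) ≤ (k : ℝ) ^ 2 := by
    rw [Nat.cast_natAbs]
    rw [← sq_abs (k : ℝ)]
    exact_mod_cast Int.le_self_sq |k|
  have : 0 ≤ Real.pi * s ^ 2 := by positivity
  nlinarith

theorem exp_neg_pi_mul_sq_lt_one {s : ℝ} (hs : 0 < s) : Real.exp (-Real.pi * s ^ 2) < 1 := by
  rw [Real.exp_lt_one_iff]
  have : 0 < Real.pi * s ^ 2 := by positivity
  linarith

theorem summable_coef {s : ℝ} (hs : 0 < s) : Summable (coef s) :=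
  Summable.of_nonneg_of_le (fun k => (coef_pos s k).le) (coef_le_pow s)
    (hasSum_pow_natAbs (Real.exp_pos _).le (exp_neg_pi_mul_sq_lt_one hs)).summable

theorem tsum_coef_le {s : ℝ} (hs : 0 < s) (h : Real.exp (-Real.pi * s ^ 2) ≤ 1 / 9) :
    ∑' k, coef s k ≤ 1 + 3 * Real.exp (-Real.pi * s ^ 2) := by
  have h1 := hasSum_pow_natAbs (Real.exp_pos (-Real.pi * s ^ 2)).le (exp_neg_pi_mul_sq_lt_one hs)
  have h2 := (summable_coef hs).tsum_le_tsum (coef_le_pow s) h1.summable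
  rw [h1.tsum_eq] at h2
  refine h2.trans ?_
  set r := Real.exp (-Real.pi * s ^ 2)
  have hr : 0 < r := Real.exp_pos _
  have : 2 * r / (1 - r) ≤ 3 * r := by
    rw [div_le_iff₀ (by linarith)]
    nlinarith
  linarith

theorem exp_neg_pi_mul_le {x : ℝ} (hx : 1 ≤ x) : Real.exp (-Real.pi * x) ≤ 1 / 9 := by
  have h3 : Real.exp (-Real.pi * x) ≤ Real.exp (-3) := by
    rw [Real.exp_le_exp]
    nlinarith [Real.pi_gt_three]
  refine h3.trans ?_
  rw [Real.exp_neg, one_div]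
  refine inv_anti₀ (by norm_num) ?_
  have h := Real.exp_one_gt_d9
  have : Real.exp 3 = Real.exp 1 ^ 3 := by rw [← Real.exp_nat_mul]; norm_num
  rw [this]
  calc (9 : ℝ) ≤ 2.5 ^ 3 := by norm_num
    _ ≤ _ := by gcongr; linarith

/-- The weights without the one of `0`. -/
noncomputable def coefNe (s : ℝ) (k : ℤ) : ℝ := if k = 0 then 0 else coef s k

theorem coefNe_eq (s : ℝ) (k : ℤ) : coefNe s k = coef s k - if k = 0 then 1 else 0 := by
  by_cases h : k = 0
  · simp [coefNe, h, coef_zero]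
  · simp [coefNe, h]

theorem coefNe_nonneg (s : ℝ) (k : ℤ) : 0 ≤ coefNe s k := by
  unfold coefNe; split_ifs; exacts [le_rfl, (coef_pos s k).le]

theorem hasSum_coefNe {s : ℝ} (hs : 0 < s) : HasSum (coefNe s) (∑' k, coef s k - 1) := by
  have h : coefNe s = fun k => coef s k - if k = 0 then 1 else 0 := funext (coefNe_eq s)
  rw [h]
  exact (summable_coef hs).hasSum.sub (hasSum_ite_eq (0 : ℤ) (1 : ℝ))

/-- The functional equation of the theta function with parameters `a = β²` and `b = ix`: since `i·ix
= -x`, one side is a sum of shifted Gaussians, and the real part of the other is the cosine series.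
-/
theorem poisson_rho {β : ℝ} (hβ : 0 < β) (x : ℝ) :
    ∑' k : ℤ, rho β ((k : ℝ) - x) = β * ∑' k : ℤ, coef β k * Real.cos (2 * Real.pi * (k * x)) := by
  have hβ2 : 0 < ((β ^ 2 : ℝ) : ℂ).re := by rw [Complex.ofReal_re]; positivity
  have h := Complex.tsum_exp_neg_quadratic hβ2 (Complex.I * x)
  have hb : ((β ^ 2 : ℝ) : ℂ) ^ (1 / 2 : ℂ) = (β : ℂ) := by
    rw [show (1 / 2 : ℂ) = ((1 / 2 : ℝ) : ℂ) by push_cast; rfl, ← Complex.ofReal_cpow (by positivity),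
      ← Real.sqrt_eq_rpow, Real.sqrt_sq hβ.le]
  have hr : ∀ k : ℤ, Complex.exp (-Real.pi / ((β ^ 2 : ℝ) : ℂ) * (k + Complex.I * (Complex.I * x)) ^ 2)
      = ((rho β ((k : ℝ) - x) : ℝ) : ℂ) := by
    intro k
    rw [rho, Complex.ofReal_exp]
    congr 1
    rw [← mul_assoc, Complex.I_mul_I, norm_smul, mul_pow, Real.norm_eq_abs, Real.norm_eq_abs,
      sq_abs, sq_abs]
    push_cast
    have : (β : ℂ) ≠ 0 := by exact_mod_cast hβ.ne'
    field_simp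
    ring
  have hl : ∀ k : ℤ, (Complex.exp (-Real.pi * ((β ^ 2 : ℝ) : ℂ) * (k : ℂ) ^ 2 +
      2 * Real.pi * (Complex.I * x) * k)).re = coef β k * Real.cos (2 * Real.pi * (k * x)) := by
    intro k
    rw [show (-Real.pi * ((β ^ 2 : ℝ) : ℂ) * (k : ℂ) ^ 2 + 2 * Real.pi * (Complex.I * x) * k) =
      ((-Real.pi * β ^ 2 * (k : ℝ) ^ 2 : ℝ) : ℂ) + ((2 * Real.pi * (k * x) : ℝ) : ℂ) * Complex.I by
        push_cast; ring, Complex.exp_re]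
    congr 2 <;> simp [-Complex.ofReal_mul, -Complex.ofReal_neg]
  have hs : Summable fun k : ℤ => Complex.exp (-Real.pi * ((β ^ 2 : ℝ) : ℂ) * (k : ℂ) ^ 2 +
      2 * Real.pi * (Complex.I * x) * k) := by
    refine Summable.of_norm ((summable_coef hβ).congr fun k => ?_)
    rw [Complex.norm_exp, coef]
    congr 1
    rw [show (-Real.pi * ((β ^ 2 : ℝ) : ℂ) * (k : ℂ) ^ 2 + 2 * Real.pi * (Complex.I * x) * k) =
      ((-Real.pi * β ^ 2 * (k : ℝ) ^ 2 : ℝ) : ℂ) + ((2 * Real.pi * (k * x) : ℝ) : ℂ) * Complex.I by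
        push_cast; ring]
    simp [-Complex.ofReal_mul, -Complex.ofReal_neg]
  simp only [hr] at h
  rw [hb, ← Complex.ofReal_tsum] at h
  have h3 := congrArg Complex.re h
  rw [Complex.re_tsum hs] at h3
  simp only [hl] at h3
  rw [h3, one_div, ← Complex.ofReal_inv, ← Complex.ofReal_mul, Complex.ofReal_re,
    mul_inv_cancel_left₀ hβ.ne']

/-- Poisson summation at 0 trades the slowly decaying series for `β⁻¹` times the one with parameter
`β⁻¹ > 1`, whose sum is at most 4/3. -/
theorem tsum_coef_sub_one_le {β : ℝ} (hβ : 0 < β) (hβ1 : β < 1) :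
    ∑' k, coef β k - 1 ≤ 3 / (2 * β) := by
  have h := poisson_rho hβ 0
  simp only [sub_zero, mul_zero, Real.cos_zero, mul_one] at h
  have h1 : ∀ k : ℤ, rho β (k : ℝ) = coef β⁻¹ k := by
    intro k
    rw [rho, coef, norm_smul, mul_pow, Real.norm_eq_abs, Real.norm_eq_abs, sq_abs, sq_abs, mul_assoc]
  simp only [h1] at h
  have h2 := tsum_coef_le (s := β⁻¹) (by positivity)
    (exp_neg_pi_mul_le (one_le_pow₀ (one_le_inv_iff₀.2 ⟨hβ, hβ1.le⟩)))
  have h3 := exp_neg_pi_mul_le (x := β⁻¹ ^ 2) (one_le_pow₀ (one_le_inv_iff₀.2 ⟨hβ, hβ1.le⟩))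
  have h4 : ∑' k, coef β k ≤ 3 / (2 * β) := by
    rw [le_div_iff₀ (by positivity)]
    linarith
  linarith

end Coefficients

/-! ### The centred series and its correlations between directions. -/

section Series

variable {n : ℕ}

/-- The `1`-periodic function `∑ₖ exp (-π β² k²) cos (2 π k t)`. -/
noncomputable def cosSeries (β t : ℝ) : ℝ :=
  ∑' k : ℤ, coef β k * Real.cos (2 * Real.pi * (k * t))

/-- The mean of `y ↦ cosSeries β (γ ⟪y, w⟫)` under the standard Gaussian, for a unit vector `w`. -/
noncomputable def cosMean (β γ : ℝ) : ℝ := ∑' k : ℤ, coef β k * coef γ k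

theorem abs_coef_mul_cos_le (β t : ℝ) (k : ℤ) :
    |coef β k * Real.cos (2 * Real.pi * (k * t))| ≤ coef β k := by
  rw [abs_mul, abs_of_pos (coef_pos β k)]
  exact mul_le_of_le_one_right (coef_pos β k).le (Real.abs_cos_le_one _)

theorem summable_cosSeries {β : ℝ} (hβ : 0 < β) (t : ℝ) :
    Summable fun k : ℤ => coef β k * Real.cos (2 * Real.pi * (k * t)) :=
  Summable.of_norm_bounded (summable_coef hβ) (abs_coef_mul_cos_le β t)

theorem continuous_cosSeries {β : ℝ} (hβ : 0 < β) : Continuous (cosSeries β) := by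
  unfold cosSeries
  exact continuous_tsum (fun _ => by fun_prop) (summable_coef hβ)
    (fun k t => abs_coef_mul_cos_le β t k)

theorem abs_cosSeries_le {β : ℝ} (hβ : 0 < β) (t : ℝ) : |cosSeries β t| ≤ ∑' k, coef β k := by
  rw [← Real.norm_eq_abs]
  exact tsum_of_norm_bounded (summable_coef hβ).hasSum (abs_coef_mul_cos_le β t)

/-- Invisible on the cosine side; Poisson summation turns the series into a sum of positive terms.
-/
theorem cosSeries_nonneg {β : ℝ} (hβ : 0 < β) (t : ℝ) : 0 ≤ cosSeries β t := by
  have h := poisson_rho hβ t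
  have h2 : 0 ≤ ∑' k : ℤ, rho β ((k : ℝ) - t) := tsum_nonneg fun k => (Real.exp_pos _).le
  rw [h] at h2
  exact nonneg_of_mul_nonneg_right h2 hβ

theorem summable_cosMean {β : ℝ} (hβ : 0 < β) (γ : ℝ) :
    Summable fun k : ℤ => coef β k * coef γ k :=
  Summable.of_nonneg_of_le (fun _ => (mul_pos (coef_pos _ _) (coef_pos _ _)).le)
    (fun k => mul_le_of_le_one_right (coef_pos β k).le (coef_le_one γ k)) (summable_coef hβ)

/-- The term `k = 0` is already 1. This is why the normalization can be dropped in all upper bounds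
on shifts. -/
theorem one_le_cosMean {β : ℝ} (hβ : 0 < β) (γ : ℝ) : 1 ≤ cosMean β γ := by
  have := (summable_cosMean hβ γ).le_tsum 0
    (fun _ _ => (mul_pos (coef_pos _ _) (coef_pos _ _)).le)
  simpa only [coef_zero, mul_one, cosMean] using this

/-- The centred `k`-th term of the series in direction `w`. -/
noncomputable def fluct (γ : ℝ) (w : Space n) (k : ℤ) (y : Space n) : ℝ :=
  Real.cos (2 * Real.pi * (k * (γ * inner ℝ y w))) - coef γ k

/-- The centred series in direction `w`. -/
noncomputable def fluctSum (β γ : ℝ) (w : Space n) (y : Space n) : ℝ :=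
  cosSeries β (γ * inner ℝ y w) - cosMean β γ

theorem measurable_fluct (γ : ℝ) (w : Space n) (k : ℤ) : Measurable (fluct γ w k) := by
  have : Continuous (fluct γ w k) := by unfold fluct; fun_prop
  exact this.measurable

theorem abs_fluct_le (γ : ℝ) (w : Space n) (k : ℤ) (y : Space n) : |fluct γ w k y| ≤ 2 := by
  have h1 := Real.abs_cos_le_one (2 * Real.pi * (k * (γ * inner ℝ y w)))
  have h2 := coef_le_one γ k
  have h3 := coef_pos γ k
  rw [fluct]
  rw [abs_le] at *
  constructor <;> linarith

theorem continuous_fluctSum {β : ℝ} (hβ : 0 < β) (γ : ℝ) (w : Space n) :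
    Continuous (fluctSum β γ w) := by
  have := continuous_cosSeries hβ
  unfold fluctSum
  fun_prop

theorem continuous_fluctSum_left {β : ℝ} (hβ : 0 < β) (γ : ℝ) (y : Space n) :
    Continuous fun w => fluctSum β γ w y := by
  have := continuous_cosSeries hβ
  unfold fluctSum
  fun_prop

theorem measurable_fluctSum {β : ℝ} (hβ : 0 < β) (γ : ℝ) (w : Space n) :
    Measurable (fluctSum β γ w) :=
  (continuous_fluctSum hβ γ w).measurable

theorem abs_fluctSum_le {β : ℝ} (hβ : 0 < β) (γ : ℝ) (w y : Space n) :
    |fluctSum β γ w y| ≤ ∑' k, coef β k + cosMean β γ := by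
  have h1 := abs_cosSeries_le hβ (γ * inner ℝ y w)
  have h2 := one_le_cosMean hβ γ
  rw [fluctSum]
  rw [abs_le] at *
  constructor <;> linarith

theorem fluctSum_eq_tsum {β : ℝ} (hβ : 0 < β) (γ : ℝ) (w y : Space n) :
    fluctSum β γ w y = ∑' k, coef β k * fluct γ w k y := by
  rw [fluctSum, cosSeries, cosMean,
    ← (summable_cosSeries hβ _).tsum_sub (summable_cosMean hβ γ)]
  simp only [fluct, mul_sub]

theorem hasSum_integral_mul_fluctSum {β : ℝ} (hβ : 0 < β) (γ : ℝ) (w : Space n)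
    {F : Space n → ℝ} (hF : Measurable F) {C : ℝ} (hC : ∀ y, |F y| ≤ C) :
    HasSum (fun k => coef β k * ∫ y, F y * fluct γ w k y ∂(stdGaussian n))
      (∫ y, F y * fluctSum β γ w y ∂(stdGaussian n)) := by
  have hC0 : 0 ≤ C := (abs_nonneg _).trans (hC 0)
  have hb : ∀ (k : ℤ) y, |coef β k * (F y * fluct γ w k y)| ≤ coef β k * (C * 2) := by
    intro k y
    rw [abs_mul, abs_mul, abs_of_pos (coef_pos β k)]
    have := abs_fluct_le γ w k y
    gcongr
    exacts [(coef_pos β k).le, hC y]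
  have hm : ∀ k : ℤ, Measurable fun y => coef β k * (F y * fluct γ w k y) := fun k =>
    (hF.mul (measurable_fluct γ w k)).const_mul _
  have hi : ∀ k : ℤ, Integrable (fun y => coef β k * (F y * fluct γ w k y)) (stdGaussian n) :=
    fun k => integrable_of_bounded (hm k) (hb k)
  have h := hasSum_integral_of_summable_integral_norm hi (by
    refine Summable.of_nonneg_of_le (fun k => integral_nonneg fun y => norm_nonneg _) (fun k => ?_)
      ((summable_coef hβ).mul_right (C * 2))
    calc _ ≤ ∫ _, coef β k * (C * 2) ∂(stdGaussian n) :=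
          integral_mono (hi k).norm (integrable_const _) (hb k)
      _ = _ := by simp)
  simp only [integral_const_mul] at h
  suffices e : ∀ y, F y * fluctSum β γ w y = ∑' k, coef β k * (F y * fluct γ w k y) by
    simpa only [e] using h
  intro y
  rw [fluctSum_eq_tsum hβ, ← tsum_mul_left]
  refine tsum_congr fun k => ?_
  ring

theorem integral_cos_inner (γ : ℝ) {w : Space n} (hw : ‖w‖ = 1) (k : ℤ) :
    ∫ y, Real.cos (2 * Real.pi * (k * (γ * inner ℝ y w))) ∂(stdGaussian n) = coef γ k := by
  have h := integral_cos_stdGaussian ((k * γ) • w)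
  simp only [inner_smul_right, norm_smul, hw, mul_one, Real.norm_eq_abs, sq_abs] at h
  rw [coef, show -Real.pi * γ ^ 2 * (k : ℝ) ^ 2 = -Real.pi * (k * γ) ^ 2 by ring, ← h]
  simp only [mul_assoc]

theorem integrable_cos_inner (v : Space n) :
    Integrable (fun y => Real.cos (2 * Real.pi * inner ℝ y v)) (stdGaussian n) := by
  refine integrable_of_bounded (C := 1) ?_ (fun y => Real.abs_cos_le_one _)
  exact Continuous.measurable (by fun_prop)

theorem integral_linear_combination {X : Type*} [MeasurableSpace X] {μ : Measure X}
    [IsProbabilityMeasure μ] {f₁ f₂ f₃ f₄ : X → ℝ} (h₁ : Integrable f₁ μ) (h₂ : Integrable f₂ μ)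
    (h₃ : Integrable f₃ μ) (h₄ : Integrable f₄ μ) (a b c d : ℝ) :
    ∫ x, a * (f₁ x + f₂ x) - (b * f₃ x + c * f₄ x) + d ∂μ =
      a * (∫ x, f₁ x ∂μ + ∫ x, f₂ x ∂μ) - (b * ∫ x, f₃ x ∂μ + c * ∫ x, f₄ x ∂μ) + d := by
  have i1 : Integrable (fun x => a * (f₁ x + f₂ x)) μ := (h₁.add h₂).const_mul a
  have i2 : Integrable (fun x => b * f₃ x + c * f₄ x) μ := (h₃.const_mul b).add (h₄.const_mul c)
  have i3 : Integrable (fun x => a * (f₁ x + f₂ x) - (b * f₃ x + c * f₄ x)) μ := i1.sub i2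
  rw [integral_add i3 (integrable_const _), integral_sub i1 i2, integral_const_mul,
    integral_add h₁ h₂, integral_add (h₃.const_mul b) (h₄.const_mul c), integral_const_mul,
    integral_const_mul]
  simp

/-- The covariance of two terms in directions `w` and `w'`. -/
noncomputable def fluctCov (γ : ℝ) (w w' : Space n) (j k : ℤ) : ℝ :=
  ∫ y, fluct γ w j y * fluct γ w' k y ∂(stdGaussian n)

theorem fluctCov_eq (γ : ℝ) {w w' : Space n} (hw : ‖w‖ = 1) (hw' : ‖w'‖ = 1) (j k : ℤ) :
    fluctCov γ w w' j k =
      (Real.exp (-Real.pi * γ ^ 2 * (j ^ 2 + k ^ 2 + 2 * j * k * inner ℝ w w')) +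
       Real.exp (-Real.pi * γ ^ 2 * (j ^ 2 + k ^ 2 - 2 * j * k * inner ℝ w w'))) / 2
      - coef γ j * coef γ k := by
  have e : ∀ y, fluct γ w j y * fluct γ w' k y =
      (1 / 2) * (Real.cos (2 * Real.pi * inner ℝ y ((j * γ) • w + (k * γ) • w')) +
        Real.cos (2 * Real.pi * inner ℝ y ((j * γ) • w - (k * γ) • w'))) -
      (coef γ k * Real.cos (2 * Real.pi * inner ℝ y ((j * γ) • w)) +
       coef γ j * Real.cos (2 * Real.pi * inner ℝ y ((k * γ) • w'))) + coef γ j * coef γ k := by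
    intro y
    simp only [inner_add_right, inner_sub_right, inner_smul_right, fluct, mul_add, mul_sub,
      Real.cos_add, Real.cos_sub, ← mul_assoc]
    ring
  have n1 : ∀ (a b : ℝ), ‖a • w + b • w'‖ ^ 2 = a ^ 2 + b ^ 2 + 2 * a * b * inner ℝ w w' := by
    intro a b
    rw [norm_add_sq_real, norm_smul, norm_smul, hw, hw', inner_smul_left, inner_smul_right]
    simp only [mul_one, Real.norm_eq_abs, sq_abs, conj_trivial]
    ring
  have n2 : ∀ (a b : ℝ), ‖a • w - b • w'‖ ^ 2 = a ^ 2 + b ^ 2 - 2 * a * b * inner ℝ w w' := by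
    intro a b
    have := n1 a (-b)
    rw [neg_smul, ← sub_eq_add_neg] at this
    rw [this]; ring
  have i := fun v : Space n => integrable_cos_inner v
  rw [fluctCov, integral_congr_ae (Filter.Eventually.of_forall e),
    integral_linear_combination (i _) (i _) (i _) (i _)]
  simp only [integral_cos_stdGaussian, n1, n2, norm_smul, hw, hw', mul_one, Real.norm_eq_abs, sq_abs]
  have hj : Real.exp (-Real.pi * (j * γ) ^ 2) = coef γ j := by rw [coef]; ring_nf
  have hk : Real.exp (-Real.pi * (k * γ) ^ 2) = coef γ k := by rw [coef]; ring_nf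
  rw [hj, hk]
  ring_nf

theorem fluctCov_zero_left (γ : ℝ) (w w' : Space n) (k : ℤ) : fluctCov γ w w' 0 k = 0 := by
  simp [fluctCov, fluct, coef_zero]

theorem fluctCov_zero_right (γ : ℝ) (w w' : Space n) (j : ℤ) : fluctCov γ w w' j 0 = 0 := by
  simp [fluctCov, fluct, coef_zero]

/-- Each exponential in `fluctCov_eq` is positive and below the right side, because `2|jkt| ≤ s(j² +
k²)` for `|t| ≤ s`; so is the difference in absolute value. The bound factors in `j` and `k`, which
makes the double series over both a perfect square. -/
theorem abs_fluctCov_le (γ : ℝ) {w w' : Space n} (hw : ‖w‖ = 1) (hw' : ‖w'‖ = 1) {s : ℝ}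
    (hs : |inner ℝ w w'| ≤ s) (j k : ℤ) :
    |fluctCov γ w w' j k| ≤
      Real.exp (-Real.pi * γ ^ 2 * (1 - s) * j ^ 2) * Real.exp (-Real.pi * γ ^ 2 * (1 - s) * k ^ 2) := by
  have hs0 : 0 ≤ s := (abs_nonneg _).trans hs
  have hg : 0 ≤ Real.pi * γ ^ 2 := by positivity
  have key : ∀ t : ℝ, |t| ≤ s →
      Real.exp (-Real.pi * γ ^ 2 * (j ^ 2 + k ^ 2 + 2 * j * k * t)) ≤
      Real.exp (-Real.pi * γ ^ 2 * (1 - s) * j ^ 2) * Real.exp (-Real.pi * γ ^ 2 * (1 - s) * k ^ 2) := by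
    intro t ht
    rw [← Real.exp_add, Real.exp_le_exp]
    have h1 : -(s * ((j : ℝ) ^ 2 + k ^ 2)) ≤ 2 * j * k * t := by
      have h2 : |2 * (j : ℝ) * k * t| ≤ (j ^ 2 + k ^ 2) * s := by
        rw [abs_mul]
        refine mul_le_mul ?_ ht (abs_nonneg _) (by positivity)
        rw [abs_le]
        constructor <;> nlinarith [sq_nonneg ((j : ℝ) + k), sq_nonneg ((j : ℝ) - k)]
      have := (abs_le.1 h2).1
      linarith
    nlinarith
  have k0 := key 0 (by simpa using hs0)
  have k1 := key _ hs
  have k2 := key (-inner ℝ w w') (by rwa [abs_neg])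
  have e0 : Real.exp (-Real.pi * γ ^ 2 * (j ^ 2 + k ^ 2 + 2 * j * k * 0)) = coef γ j * coef γ k := by
    rw [coef, coef, ← Real.exp_add]; ring_nf
  rw [e0] at k0
  rw [show (j : ℝ) ^ 2 + k ^ 2 + 2 * j * k * -inner ℝ w w' =
    j ^ 2 + k ^ 2 - 2 * j * k * inner ℝ w w' by ring] at k2
  rw [fluctCov_eq γ hw hw', abs_le]
  have p0 := mul_pos (coef_pos γ j) (coef_pos γ k)
  have p1 := Real.exp_pos (-Real.pi * γ ^ 2 * (j ^ 2 + k ^ 2 + 2 * j * k * inner ℝ w w'))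
  have p2 := Real.exp_pos (-Real.pi * γ ^ 2 * (j ^ 2 + k ^ 2 - 2 * j * k * inner ℝ w w'))
  constructor <;> linarith

theorem abs_integral_fluctSum_mul_le {β : ℝ} (hβ : 0 < β) (γ : ℝ) (w w' : Space n)
    {d : ℤ → ℝ} {D : ℝ} (hd : ∀ j k, |fluctCov γ w w' j k| ≤ d j * d k)
    (hs : HasSum (fun k => coef β k * d k) D) :
    |∫ y, fluctSum β γ w y * fluctSum β γ w' y ∂(stdGaussian n)| ≤ D ^ 2 := by
  have h1 := hasSum_integral_mul_fluctSum hβ γ w' (measurable_fluctSum hβ γ w)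
    (abs_fluctSum_le hβ γ w)
  have h2 : ∀ k, |∫ y, fluctSum β γ w y * fluct γ w' k y ∂(stdGaussian n)| ≤ D * d k := by
    intro k
    have h3 := hasSum_integral_mul_fluctSum hβ γ w (measurable_fluct γ w' k) (abs_fluct_le γ w' k)
    have h4 : ∫ y, fluctSum β γ w y * fluct γ w' k y ∂(stdGaussian n) =
        ∑' j, coef β j * fluctCov γ w w' j k := by
      simp only [mul_comm (fluctSum β γ w _)]
      rw [← h3.tsum_eq]
      refine tsum_congr fun j => ?_
      simp only [fluctCov, mul_comm (fluct γ w j _)]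
    rw [h4, ← Real.norm_eq_abs]
    refine tsum_of_norm_bounded (hs.mul_right (d k)) fun j => ?_
    rw [Real.norm_eq_abs, abs_mul, abs_of_pos (coef_pos β j), mul_assoc]
    exact mul_le_mul_of_nonneg_left (hd j k) (coef_pos β j).le
  rw [← h1.tsum_eq, sq, ← Real.norm_eq_abs]
  refine tsum_of_norm_bounded (hs.mul_left D) fun k => ?_
  rw [Real.norm_eq_abs, abs_mul, abs_of_pos (coef_pos β k), mul_left_comm]
  exact mul_le_mul_of_nonneg_left (h2 k) (coef_pos β k).le

theorem abs_integral_fluctSum_mul_le_of_norm {β : ℝ} (hβ : 0 < β) (hβ1 : β < 1) (γ : ℝ)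
    {w w' : Space n} (hw : ‖w‖ = 1) (hw' : ‖w'‖ = 1) :
    |∫ y, fluctSum β γ w y * fluctSum β γ w' y ∂(stdGaussian n)| ≤ (3 / (2 * β)) ^ 2 := by
  -- For `s = 1` the covariance bound is just 1, and covariances with index 0 vanish, so the factor
  -- `d` is the indicator of `k ≠ 0`.
  have hs : HasSum (fun k : ℤ => coef β k * (if k = 0 then 0 else 1)) (∑' k, coef β k - 1) := by
    have e : coefNe β = fun k : ℤ => coef β k * (if k = 0 then 0 else 1) := by
      funext k
      unfold coefNe
      split_ifs <;> simp
    simpa only [← e] using hasSum_coefNe hβ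
  have h0 : 0 ≤ ∑' k, coef β k - 1 := (hasSum_coefNe hβ).nonneg (coefNe_nonneg β)
  refine (abs_integral_fluctSum_mul_le hβ γ w w' (fun j k => ?_) hs).trans
    (pow_le_pow_left₀ h0 (tsum_coef_sub_one_le hβ hβ1) 2)
  · by_cases hj : j = 0
    · simp [hj, fluctCov_zero_left]
    by_cases hk : k = 0
    · simp [hk, fluctCov_zero_right]
    have hin : |inner ℝ w w'| ≤ 1 := by
      simpa [hw, hw'] using abs_real_inner_le_norm w w'
    simpa [hj, hk] using abs_fluctCov_le γ hw hw' hin j k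

theorem abs_integral_fluctSum_mul_le_of_inner {β γ τ : ℝ} (hβ : 0 < β) (hγ : √2 ≤ γ)
    (hτ : 4 * Real.exp (-Real.pi * γ ^ 2 / 4) ≤ τ)
    {w w' : Space n} (hw : ‖w‖ = 1) (hw' : ‖w'‖ = 1) (h : |inner ℝ w w'| ≤ 1 / 2) :
    |∫ y, fluctSum β γ w y * fluctSum β γ w' y ∂(stdGaussian n)| ≤ τ ^ 2 / 16 := by
  have hγ0 : 0 < γ := lt_of_lt_of_le (by positivity) hγ
  have hγ2 : 2 ≤ γ ^ 2 := by
    have := pow_le_pow_left₀ (Real.sqrt_nonneg 2) hγ 2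
    rwa [Real.sq_sqrt (by norm_num)] at this
  -- With `|⟨w,w'⟩| ≤ 1/2` the covariance bound has exponent `-πγ²k²/2`, which is the weight `coef s
  -- k` for this `s`.
  set s : ℝ := γ / √2 with hs
  have hs0 : 0 < s := by positivity
  have hs2 : s ^ 2 = γ ^ 2 / 2 := by rw [hs, div_pow, Real.sq_sqrt (by norm_num)]
  have hr := exp_neg_pi_mul_le (x := s ^ 2) (by rw [hs2]; linarith)
  have hsum : Summable fun k => coef β k * coefNe s k :=
    Summable.of_nonneg_of_le (fun k => mul_nonneg (coef_pos β k).le (coefNe_nonneg s k))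
      (fun k => mul_le_of_le_one_left (coefNe_nonneg s k) (coef_le_one β k))
      (hasSum_coefNe hs0).summable
  have hle : ∑' k, coef β k * coefNe s k ≤ 3 * Real.exp (-Real.pi * s ^ 2) := by
    have h1 := hsum.tsum_le_tsum
      (fun k => mul_le_of_le_one_left (coefNe_nonneg s k) (coef_le_one β k))
      (hasSum_coefNe hs0).summable
    rw [(hasSum_coefNe hs0).tsum_eq] at h1
    have := tsum_coef_le hs0 hr
    linarith
  have h0 : 0 ≤ ∑' k, coef β k * coefNe s k :=
    tsum_nonneg fun k => mul_nonneg (coef_pos β k).le (coefNe_nonneg s k)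
  refine (abs_integral_fluctSum_mul_le hβ γ w w' (fun j k => ?_)
    hsum.hasSum).trans ((pow_le_pow_left₀ h0 hle 2).trans ?_)
  · by_cases hj : j = 0
    · simp [hj, fluctCov_zero_left, coefNe]
    by_cases hk : k = 0
    · simp [hk, fluctCov_zero_right, coefNe]
    have := abs_fluctCov_le γ hw hw' h j k
    simp only [coefNe, hj, hk, if_false, coef, hs2]
    convert this using 3 <;> ring
  -- With `r = exp(-πγ²/4)`, the bound is `(3r²)² = 9r⁴ ≤ r² ≤ τ²/16`, from `r² ≤ 1/9` and `4r ≤ τ`.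
  · have h4 : Real.exp (-Real.pi * s ^ 2) = Real.exp (-Real.pi * γ ^ 2 / 4) ^ 2 := by
      rw [← Real.exp_nat_mul, hs2]; congr 1; push_cast; ring
    rw [h4] at hr ⊢
    set r := Real.exp (-Real.pi * γ ^ 2 / 4)
    have hr0 : 0 < r := Real.exp_pos _
    have h5 : (4 * r) ^ 2 ≤ τ ^ 2 := pow_le_pow_left₀ (by positivity) hτ 2
    nlinarith [sq_nonneg r]

end Series

/-! ### The density relative to the Gaussian, and shifts of queries. -/

section Density

variable {n : ℕ}

theorem hclweWeight_eq {β : ℝ} (hβ : 0 < β) (γ : ℝ) (w y : Space n) :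
    hclweWeight w β γ y = rho 1 y * (β * cosSeries β (γ * inner ℝ y w)) := by
  rw [hclweWeight, poisson_rho hβ, cosSeries]

theorem measurable_cosSeries_inner {β : ℝ} (hβ : 0 < β) (γ : ℝ) (w : Space n) :
    Measurable fun y : Space n => cosSeries β (γ * inner ℝ y w) := by
  have := continuous_cosSeries hβ
  exact Continuous.measurable (by fun_prop)

theorem hclweUnnormalized_eq {β : ℝ} (hβ : 0 < β) (γ : ℝ) (w : Space n) :
    hclweUnnormalized w β γ = (stdGaussian n).withDensity
      fun y => ENNReal.ofReal (β * cosSeries β (γ * inner ℝ y w)) := by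
  rw [hclweUnnormalized, stdGaussian, ← withDensity_mul _ measurable_rho_one.ennreal_ofReal
    ((measurable_cosSeries_inner hβ γ w).const_mul β).ennreal_ofReal]
  congr 1
  funext y
  rw [hclweWeight_eq hβ, ENNReal.ofReal_mul (rho_one_pos y).le]
  rfl

theorem integral_cosSeries_inner {β : ℝ} (hβ : 0 < β) (γ : ℝ) {w : Space n} (hw : ‖w‖ = 1) :
    ∫ y, cosSeries β (γ * inner ℝ y w) ∂(stdGaussian n) = cosMean β γ := by
  have h := (hasSum_integral_mul_fluctSum hβ γ w (F := fun _ => 1) measurable_const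
    (C := 1) (by simp)).tsum_eq
  have h0 : ∀ k, ∫ y, fluct γ w k y ∂(stdGaussian n) = 0 := by
    intro k
    have hi : Integrable (fun y => Real.cos (2 * Real.pi * (k * (γ * inner ℝ y w)))) (stdGaussian n) :=
      integrable_of_bounded (C := 1) (Continuous.measurable (by fun_prop))
        (fun y => Real.abs_cos_le_one _)
    simp only [fluct]
    rw [integral_sub hi (integrable_const _), integral_cos_inner γ hw]
    simp
  simp only [one_mul, h0, mul_zero, tsum_zero, fluctSum] at h
  rw [integral_sub (integrable_of_bounded (measurable_cosSeries_inner hβ γ w)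
    (fun y => abs_cosSeries_le hβ _)) (integrable_const _)] at h
  simp only [integral_const, probReal_univ, one_smul] at h
  linarith

theorem integral_hclwe {β : ℝ} (hβ : 0 < β) (γ : ℝ) {w : Space n} (hw : ‖w‖ = 1)
    (f : Space n → ℝ) :
    ∫ y, f y ∂(hclwe w β γ) =
      (cosMean β γ)⁻¹ * ∫ y, f y * cosSeries β (γ * inner ℝ y w) ∂(stdGaussian n) := by
  have hm := ((measurable_cosSeries_inner hβ γ w).const_mul β)
  have hnn : ∀ y : Space n, 0 ≤ β * cosSeries β (γ * inner ℝ y w) := fun y =>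
    mul_nonneg hβ.le (cosSeries_nonneg hβ _)
  have hz := one_le_cosMean hβ γ
  have hu : hclweUnnormalized w β γ Set.univ = ENNReal.ofReal (β * cosMean β γ) := by
    rw [hclweUnnormalized_eq hβ, withDensity_apply _ MeasurableSet.univ, Measure.restrict_univ,
      ← ofReal_integral_eq_lintegral_ofReal _ (Filter.Eventually.of_forall hnn),
      integral_const_mul, integral_cosSeries_inner hβ γ hw]
    exact (integrable_of_bounded (measurable_cosSeries_inner hβ γ w)
      (fun y => abs_cosSeries_le hβ _)).const_mul β
  rw [hclwe, integral_smul_measure, hu, hclweUnnormalized_eq hβ,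
    integral_withDensity_eq_integral_toReal_smul hm.ennreal_ofReal (by simp),
    ENNReal.toReal_inv, ENNReal.toReal_ofReal (by positivity)]
  simp only [ENNReal.toReal_ofReal (hnn _), smul_eq_mul]
  have : ∀ y : Space n, β * cosSeries β (γ * inner ℝ y w) * f y =
    β * (f y * cosSeries β (γ * inner ℝ y w)) := fun y => by ring
  simp only [this]
  rw [integral_const_mul]
  field_simp

theorem Query.integrable (f : Query (Space n)) : Integrable f.toFun (stdGaussian n) :=
  integrable_of_bounded f.measurable_toFun f.abs_le_one

theorem integrable_query_mul (f : Query (Space n)) {F : Space n → ℝ} (hF : Measurable F) {C : ℝ}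
    (hC : ∀ y, |F y| ≤ C) : Integrable (fun y => f.toFun y * F y) (stdGaussian n) := by
  refine integrable_of_bounded (f.measurable_toFun.mul hF) (C := C) fun y => ?_
  rw [abs_mul]
  exact (mul_le_of_le_one_left (abs_nonneg _) (f.abs_le_one y)).trans (hC y)

/-- The shift of the expectation of the query `f` from the Gaussian to `H_{w,β,γ}`. -/
noncomputable def shift (β γ : ℝ) (f : Query (Space n)) (w : Space n) : ℝ :=
  ∫ y, f.toFun y ∂(hclwe w β γ) - ∫ y, f.toFun y ∂(stdGaussian n)

theorem shift_eq {β : ℝ} (hβ : 0 < β) (γ : ℝ) {w : Space n} (hw : ‖w‖ = 1)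
    (f : Query (Space n)) :
    shift β γ f w = (cosMean β γ)⁻¹ * ∫ y, f.toFun y * fluctSum β γ w y ∂(stdGaussian n) := by
  have hz := one_le_cosMean hβ γ
  rw [shift, integral_hclwe hβ γ hw]
  simp only [fluctSum, mul_sub]
  rw [integral_sub (integrable_query_mul f (measurable_cosSeries_inner hβ γ w)
    (fun y => abs_cosSeries_le hβ _)) (f.integrable.mul_const _), integral_mul_const]
  field_simp

/-- The bound does not depend on `f`, so a single partition of the sphere serves all queries. -/
theorem abs_shift_sub_le {β : ℝ} (hβ : 0 < β) (γ : ℝ) {w w' : Space n} (hw : ‖w‖ = 1)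
    (hw' : ‖w'‖ = 1) (f : Query (Space n)) :
    |shift β γ f w - shift β γ f w'| ≤
      ∫ y, |fluctSum β γ w y - fluctSum β γ w' y| ∂(stdGaussian n) := by
  have hz := one_le_cosMean hβ γ
  have hi := fun w => integrable_query_mul f (measurable_fluctSum hβ γ w) (abs_fluctSum_le hβ γ w)
  have hi' := fun w : Space n => integrable_of_bounded (measurable_fluctSum hβ γ w) (abs_fluctSum_le hβ γ w)
  rw [shift_eq hβ γ hw, shift_eq hβ γ hw', ← mul_sub, ← integral_sub (hi w) (hi w'), abs_mul,
    abs_of_pos (by positivity)]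
  refine (mul_le_of_le_one_left (abs_nonneg _) (inv_le_one_of_one_le₀ hz)).trans
    (abs_integral_le_integral_abs.trans ?_)
  refine integral_mono ((hi w).sub (hi w')).abs ((hi' w).sub (hi' w')).abs fun y => ?_
  simp only [← mul_sub, abs_mul]
  exact mul_le_of_le_one_left (abs_nonneg _) (f.abs_le_one y)

end Density

/-! ### Caps and finite partitions of the sphere. -/

section Sphere

variable {n : ℕ}

theorem isProbabilityMeasure_uniformSphere (hn : 1 ≤ n) :
    IsProbabilityMeasure (uniformSphere n) := by
  have : Nonempty (Fin n) := ⟨⟨0, hn⟩⟩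
  constructor
  rw [uniformSphere, Measure.smul_apply, smul_eq_mul]
  refine ENNReal.inv_mul_cancel ?_ (measure_ne_top _ _)
  rw [Measure.measure_univ_ne_zero]
  exact Measure.toSphere_ne_zero _

-- The uniform measure of a cap is the volume fraction of the cone over it. For `0 < r < 1`, `‖rw -
-- u/2‖² ≤ r² - 2r/5 + 1/4`, which by convexity is at most its value 0.85 at `r = 1`.
open scoped Pointwise in
theorem smul_cap_subset_closedBall (u : Space n) (hu : ‖u‖ = 1) :
    Set.Ioo (0 : ℝ) 1 • ((↑) '' {w : UnitSphere n | 2 / 5 ≤ inner ℝ (w : Space n) u}) ⊆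
      Metric.closedBall ((1 / 2 : ℝ) • u) √0.85 := by
  rintro _ ⟨r, hr, _, ⟨w, hw, rfl⟩, rfl⟩
  have hw1 : ‖(w : Space n)‖ = 1 := norm_eq_of_mem_sphere w
  simp only [Set.mem_ofPred_eq] at hw
  rw [Metric.mem_closedBall, dist_eq_norm]
  refine Real.le_sqrt_of_sq_le ?_
  simp only
  rw [norm_sub_sq_real, norm_smul, norm_smul, inner_smul_left, inner_smul_right, hw1, hu]
  simp only [mul_one, Real.norm_eq_abs, sq_abs, conj_trivial]
  have h1 := hr.1
  have h2 := hr.2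
  nlinarith [mul_le_mul_of_nonneg_left hw h1.le]

theorem measurableSet_cap (u : Space n) (a : ℝ) :
    MeasurableSet {w : UnitSphere n | a ≤ inner ℝ (w : Space n) u} :=
  (isClosed_le continuous_const (by fun_prop)).measurableSet

theorem uniformSphere_cap_le (u : Space n) (hu : ‖u‖ = 1) :
    uniformSphere n {w : UnitSphere n | 2 / 5 ≤ inner ℝ (w : Space n) u} ≤
      ENNReal.ofReal (√0.85 ^ n) := by
  rw [uniformSphere, Measure.smul_apply, smul_eq_mul,
    Measure.toSphere_apply' _ (measurableSet_cap u _), Measure.toSphere_apply_univ, mul_comm,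
    ← div_eq_mul_inv]
  refine ENNReal.div_le_of_le_mul ?_
  rw [mul_left_comm]
  gcongr
  refine (measure_mono (smul_cap_subset_closedBall u hu)).trans ?_
  rw [Measure.addHaar_closedBall _ _ (Real.sqrt_nonneg _), finrank_euclideanSpace_fin]

theorem uniformSphere_abs_inner_le (hn : 1 ≤ n) (u : Space n) (hu : ‖u‖ = 1) :
    (uniformSphere n).real {w : UnitSphere n | 2 / 5 ≤ |inner ℝ (w : Space n) u|} ≤
      2 * √0.85 ^ n := by
  have := isProbabilityMeasure_uniformSphere hn
  have h : {w : UnitSphere n | 2 / 5 ≤ |inner ℝ (w : Space n) u|} ⊆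
      {w : UnitSphere n | 2 / 5 ≤ inner ℝ (w : Space n) u} ∪
      {w : UnitSphere n | 2 / 5 ≤ inner ℝ (w : Space n) (-u)} := by
    intro w hw
    simpa only [Set.mem_union, Set.mem_ofPred_eq, inner_neg_right, le_abs] using hw
  have key : ∀ v : Space n, ‖v‖ = 1 →
      (uniformSphere n).real {w : UnitSphere n | 2 / 5 ≤ inner ℝ (w : Space n) v} ≤ √0.85 ^ n :=
    fun v hv => ENNReal.toReal_le_of_le_ofReal (by positivity) (uniformSphere_cap_le v hv)
  refine (measureReal_mono h).trans ((measureReal_union_le _ _).trans ?_)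
  have h1 := key u hu
  have h2 := key (-u) (by rwa [norm_neg])
  linarith

theorem exists_measurable_cells {X : Type*} [TopologicalSpace X] [CompactSpace X]
    [MeasurableSpace X] [BorelSpace X] [Nonempty X] (U : X → Set X) (hU : ∀ x, IsOpen (U x))
    (hx : ∀ x, x ∈ U x) :
    ∃ (N : ℕ) (pt : ℕ → X) (cell : X → ℕ), Measurable cell ∧
      ∀ x, cell x < N ∧ x ∈ U (pt (cell x)) := by
  classical
  obtain ⟨t, ht⟩ := isCompact_univ.elim_finite_subcover U hU
    (fun x _ => Set.mem_iUnion.2 ⟨x, hx x⟩)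
  let e := t.equivFin
  -- The cell of a point is the first index whose open set contains it. The default value is never
  -- used, since indices stay below `t.card`.
  let pt : ℕ → X := fun i => if h : i < t.card then (e.symm ⟨i, h⟩ : X) else Classical.arbitrary X
  have hex : ∀ x, ∃ i, i < t.card ∧ x ∈ U (pt i) := by
    intro x
    obtain ⟨y, hy, hxy⟩ := Set.mem_iUnion₂.1 (ht (Set.mem_univ x))
    refine ⟨e ⟨y, hy⟩, (e ⟨y, hy⟩).2, ?_⟩
    simpa [pt] using hxy
  refine ⟨t.card, pt, fun x => Nat.find (hex x), ?_, fun x => Nat.find_spec (hex x)⟩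
  refine measurable_find hex fun k => ?_
  by_cases hk : k < t.card
  · simpa [hk] using (hU (pt k)).measurableSet
  · simp [hk]

/-- The `L¹` distance of the (unnormalized) relative densities in directions `w` and `w'`. -/
noncomputable def fluctDist (β γ : ℝ) (w w' : Space n) : ℝ :=
  ∫ y, |fluctSum β γ w y - fluctSum β γ w' y| ∂(stdGaussian n)

theorem continuous_fluctDist {β : ℝ} (hβ : 0 < β) (γ : ℝ) (w' : Space n) :
    Continuous fun w => fluctDist β γ w w' := by
  unfold fluctDist
  refine continuous_of_dominated (F := fun w y => |fluctSum β γ w y - fluctSum β γ w' y|)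
    (bound := fun _ => 2 * (∑' k, coef β k + cosMean β γ)) ?_ ?_ (integrable_const _) ?_
  · exact fun w => ((continuous_fluctSum hβ γ w).sub (continuous_fluctSum hβ γ w')).abs.measurable.aestronglyMeasurable
  · refine fun w => Filter.Eventually.of_forall fun y => ?_
    rw [Real.norm_eq_abs, abs_abs]
    refine (abs_sub _ _).trans ?_
    have := abs_fluctSum_le hβ γ w y
    have := abs_fluctSum_le hβ γ w' y
    linarith
  · exact Filter.Eventually.of_forall fun y =>
      ((continuous_fluctSum_left hβ γ y).sub continuous_const).abs

theorem exists_sphere_cells (hn : 1 ≤ n) {β δ : ℝ} (hβ : 0 < β) (γ : ℝ) (hδ : 0 < δ) :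
    ∃ (N : ℕ) (pt : ℕ → UnitSphere n) (cell : UnitSphere n → ℕ), Measurable cell ∧
      (∀ w, cell w < N) ∧ (∀ w : UnitSphere n, ‖(w : Space n) - pt (cell w)‖ ≤ 1 / 10) ∧
      ∀ (w : UnitSphere n) (f : Query (Space n)),
        |shift β γ f w - shift β γ f (pt (cell w))| ≤ δ := by
  have : Nonempty (Fin n) := ⟨⟨0, hn⟩⟩
  have : Nonempty (UnitSphere n) := (NormedSpace.sphere_nonempty.2 zero_le_one).to_subtype
  have hU : ∀ x : UnitSphere n, IsOpen ({w : UnitSphere n | ‖(w : Space n) - x‖ < 1 / 10} ∩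
      {w : UnitSphere n | fluctDist β γ (w : Space n) (x : Space n) < δ}) := by
    intro x
    have hc : Continuous fun w : UnitSphere n => fluctDist β γ (w : Space n) (x : Space n) :=
      (continuous_fluctDist hβ γ (x : Space n)).comp continuous_subtype_val
    exact (isOpen_lt (by fun_prop) continuous_const).inter (isOpen_lt hc continuous_const)
  have hx : ∀ x : UnitSphere n, x ∈ ({w : UnitSphere n | ‖(w : Space n) - x‖ < 1 / 10} ∩
      {w : UnitSphere n | fluctDist β γ (w : Space n) (x : Space n) < δ}) := fun x => by
    simp [fluctDist, hδ]
  obtain ⟨N, pt, cell, hm, h⟩ := exists_measurable_cells _ hU hx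
  refine ⟨N, pt, cell, hm, fun w => (h w).1, fun w => (h w).2.1.le, fun w f => ?_⟩
  exact (abs_shift_sub_le hβ γ (norm_eq_of_mem_sphere w) (norm_eq_of_mem_sphere _) f).trans
    (h w).2.2.le

end Sphere

/-! ### Few directions are bad for a given query. -/

section SecondMoment

variable {n : ℕ}

/-- Cauchy–Schwarz with `|f| ≤ 1`: integrate `G² ≥ 2l·fG - l²`, which comes from `(G - lf)² ≥ 0`,
where `l` is the integral of `fG`. -/
theorem sq_integral_query_mul_le (f : Query (Space n)) {G : Space n → ℝ} (hG : Measurable G)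
    {C : ℝ} (hC : ∀ y, |G y| ≤ C) :
    (∫ y, f.toFun y * G y ∂(stdGaussian n)) ^ 2 ≤ ∫ y, G y * G y ∂(stdGaussian n) := by
  set l := ∫ y, f.toFun y * G y ∂(stdGaussian n) with hl
  have hC0 : 0 ≤ C := (abs_nonneg _).trans (hC 0)
  have i1 : Integrable (fun y => G y * G y) (stdGaussian n) :=
    integrable_of_bounded (hG.mul hG) (C := C * C) fun y => by
      rw [abs_mul]; exact mul_le_mul (hC y) (hC y) (abs_nonneg _) hC0
  have i2 := integrable_query_mul f hG hC
  have i3 : Integrable (fun y => 2 * l * (f.toFun y * G y) - l ^ 2) (stdGaussian n) :=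
    (i2.const_mul _).sub (integrable_const _)
  have h := integral_mono i3 i1 fun y => by
    have h1 : f.toFun y ^ 2 ≤ 1 := (sq_le_one_iff_abs_le_one _).2 (f.abs_le_one y)
    simp only
    nlinarith [sq_nonneg (G y - l * f.toFun y), mul_le_mul_of_nonneg_left h1 (sq_nonneg l)]
  rw [integral_sub (i2.const_mul _) (integrable_const _), integral_const_mul, ← hl] at h
  simp only [integral_const, probReal_univ, one_smul] at h
  linarith

/-- Sign the weights so that all inner products with `f` add up without cancellation, apply
Cauchy–Schwarz to the signed combination of series, and expand its square. -/
theorem sq_sum_weights_le {β : ℝ} (hβ : 0 < β) (γ : ℝ) (f : Query (Space n)) {ι : Type*}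
    (S : Finset ι) (p : ι → ℝ) (hp : ∀ i, 0 ≤ p i) (w : ι → Space n) (hw : ∀ i, ‖w i‖ = 1)
    {T : ℝ} (hT : 0 ≤ T) (hS : ∀ i ∈ S, T ≤ |shift β γ f (w i)|) :
    T ^ 2 * (∑ i ∈ S, p i) ^ 2 ≤ ∑ i ∈ S, p i * ∑ j ∈ S, p j *
      |∫ y, fluctSum β γ (w i) y * fluctSum β γ (w j) y ∂(stdGaussian n)| := by
  have hz := one_le_cosMean hβ γ
  set I : ι → ℝ := fun i => ∫ y, f.toFun y * fluctSum β γ (w i) y ∂(stdGaussian n) with hI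
  set q : ι → ℝ := fun i => p i * SignType.sign (I i) with hq
  have hqa : ∀ i, |q i| ≤ p i := by
    intro i
    rw [hq, abs_mul, abs_of_nonneg (hp i)]
    refine mul_le_of_le_one_right (hp i) ?_
    rcases SignType.sign (I i) with _ | _ | _ <;> simp
  set B := ∑' k, coef β k + cosMean β γ with hB
  have hB0 : 0 ≤ B := (abs_nonneg _).trans (abs_fluctSum_le hβ γ (0 : Space n) 0)
  have hm : Measurable fun y => ∑ i ∈ S, q i * fluctSum β γ (w i) y :=
    Finset.measurable_sum _ fun i _ => (measurable_fluctSum hβ γ (w i)).const_mul _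
  have hb : ∀ y, |∑ i ∈ S, q i * fluctSum β γ (w i) y| ≤ ∑ i ∈ S, p i * B := fun y =>
    (Finset.abs_sum_le_sum_abs _ _).trans (Finset.sum_le_sum fun i _ => by
      rw [abs_mul]
      exact mul_le_mul (hqa i) (abs_fluctSum_le hβ γ (w i) y) (abs_nonneg _) (hp i))
  have h1 := sq_integral_query_mul_le f hm hb
  have e1 : ∫ y, f.toFun y * ∑ i ∈ S, q i * fluctSum β γ (w i) y ∂(stdGaussian n) =
      ∑ i ∈ S, p i * |I i| := by
    simp only [Finset.mul_sum, mul_left_comm (f.toFun _)]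
    rw [integral_finsetSum _ fun i _ => (integrable_query_mul f (measurable_fluctSum hβ γ (w i))
      (abs_fluctSum_le hβ γ (w i))).const_mul _]
    refine Finset.sum_congr rfl fun i _ => ?_
    rw [integral_const_mul, hq, ← sign_mul_self (I i), mul_assoc]
  have h2 : T * ∑ i ∈ S, p i ≤ ∑ i ∈ S, p i * |I i| := by
    rw [Finset.mul_sum]
    refine Finset.sum_le_sum fun i hi => ?_
    rw [mul_comm]
    refine mul_le_mul_of_nonneg_left ((hS i hi).trans ?_) (hp i)
    rw [shift_eq hβ γ (hw i), abs_mul, abs_of_pos (by positivity)]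
    exact mul_le_of_le_one_left (abs_nonneg _) (inv_le_one_of_one_le₀ hz)
  have h3 : (T * ∑ i ∈ S, p i) ^ 2 ≤ (∑ i ∈ S, p i * |I i|) ^ 2 :=
    pow_le_pow_left₀ (mul_nonneg hT (Finset.sum_nonneg fun i _ => hp i)) h2 2
  rw [e1] at h1
  rw [mul_pow] at h3
  refine h3.trans (h1.trans ?_)
  have i2 : ∀ i j, Integrable (fun y => fluctSum β γ (w i) y * fluctSum β γ (w j) y)
      (stdGaussian n) := fun i j =>
    integrable_of_bounded ((measurable_fluctSum hβ γ _).mul (measurable_fluctSum hβ γ _))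
      (C := B * B) fun y => by
        rw [abs_mul]
        exact mul_le_mul (abs_fluctSum_le hβ γ _ y) (abs_fluctSum_le hβ γ _ y) (abs_nonneg _) hB0
  have e2 : ∀ y, (∑ i ∈ S, q i * fluctSum β γ (w i) y) * (∑ i ∈ S, q i * fluctSum β γ (w i) y) =
      ∑ i ∈ S, ∑ j ∈ S, q i * q j * (fluctSum β γ (w i) y * fluctSum β γ (w j) y) := by
    intro y
    rw [Finset.sum_mul_sum]
    refine Finset.sum_congr rfl fun i _ => Finset.sum_congr rfl fun j _ => ?_
    ring
  simp only [e2]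
  rw [integral_finsetSum _ fun i _ => integrable_finsetSum _ fun j _ => (i2 i j).const_mul _]
  refine Finset.sum_le_sum fun i _ => ?_
  rw [integral_finsetSum _ fun j _ => (i2 i j).const_mul _, Finset.mul_sum]
  refine Finset.sum_le_sum fun j _ => ?_
  rw [integral_const_mul]
  refine (le_abs_self _).trans ?_
  rw [abs_mul, abs_mul, ← mul_assoc]
  exact mul_le_mul_of_nonneg_right (mul_le_mul (hqa i) (hqa j) (abs_nonneg _) (hp i))
    (abs_nonneg _)

theorem sum_measureReal_cells {X : Type*} [MeasurableSpace X] (μ : Measure X) [IsFiniteMeasure μ]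
    {cell : X → ℕ} (hc : Measurable cell) (J : Finset ℕ) :
    ∑ j ∈ J, μ.real (cell ⁻¹' {j}) = μ.real (cell ⁻¹' J) :=
  sum_measureReal_preimage_singleton J fun j _ => hc (measurableSet_singleton j)

theorem sum_cells_le (hn : 1 ≤ n) {β γ τ : ℝ} (hβ : 0 < β) (hβ1 : β < 1) (hγ : √2 ≤ γ)
    (hτ : 4 * Real.exp (-Real.pi * γ ^ 2 / 4) ≤ τ) (pt : ℕ → UnitSphere n)
    {cell : UnitSphere n → ℕ} (hc : Measurable cell)
    (hd : ∀ w : UnitSphere n, ‖(w : Space n) - pt (cell w)‖ ≤ 1 / 10) (f : Query (Space n)) (S : Finset ℕ)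
    (hS : ∀ i ∈ S, 9 / 10 * τ ≤ |shift β γ f (pt i)|) :
    ∑ i ∈ S, (uniformSphere n).real (cell ⁻¹' {i}) ≤
      4 * γ ^ 2 / (τ ^ 2 * β ^ 2) * √0.85 ^ n := by
  have := isProbabilityMeasure_uniformSphere hn
  have hτ0 : 0 < τ := lt_of_lt_of_le (by positivity) hτ
  have hγ2 : 2 ≤ γ ^ 2 := by
    have := pow_le_pow_left₀ (Real.sqrt_nonneg 2) hγ 2
    rwa [Real.sq_sqrt (by norm_num)] at this
  set p : ℕ → ℝ := fun i => (uniformSphere n).real (cell ⁻¹' {i}) with hp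
  have hp0 : ∀ i, 0 ≤ p i := fun i => measureReal_nonneg
  have hpt : ∀ i, ‖(pt i : Space n)‖ = 1 := fun i => norm_eq_of_mem_sphere _
  have h1 := sq_sum_weights_le hβ γ f S p hp0 (fun i => (pt i : Space n)) hpt
    (T := 9 / 10 * τ) (by positivity) hS
  set P := ∑ i ∈ S, p i with hP
  set R := √0.85 ^ n with hR
  have hR0 : 0 ≤ R := by positivity
  have hP0 : 0 ≤ P := Finset.sum_nonneg fun i _ => hp0 i
  have h2 : ∀ i ∈ S, ∑ j ∈ S, p j *
      |∫ y, fluctSum β γ (pt i : Space n) y * fluctSum β γ (pt j : Space n) y ∂(stdGaussian n)| ≤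
      τ ^ 2 / 16 * P + (3 / (2 * β)) ^ 2 * (2 * R) := by
    intro i _
    classical
    have h3 : ∀ j ∈ S, p j *
        |∫ y, fluctSum β γ (pt i : Space n) y * fluctSum β γ (pt j : Space n) y ∂(stdGaussian n)| ≤
        τ ^ 2 / 16 * p j + (3 / (2 * β)) ^ 2 *
          (if 1 / 2 < |inner ℝ (pt i : Space n) (pt j)| then p j else 0) := by
      intro j _
      split_ifs with h
      · have := mul_le_mul_of_nonneg_left
          (abs_integral_fluctSum_mul_le_of_norm hβ hβ1 γ (hpt i) (hpt j)) (hp0 j)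
        have : 0 ≤ τ ^ 2 / 16 * p j := mul_nonneg (by positivity) (hp0 j)
        linarith
      · have := mul_le_mul_of_nonneg_left
          (abs_integral_fluctSum_mul_le_of_inner hβ hγ hτ (hpt i) (hpt j) (not_lt.1 h)) (hp0 j)
        linarith
    refine (Finset.sum_le_sum h3).trans ?_
    rw [Finset.sum_add_distrib, ← Finset.mul_sum, ← Finset.mul_sum, ← Finset.sum_filter]
    refine add_le_add le_rfl (mul_le_mul_of_nonneg_left ?_ (by positivity))
    refine (sum_measureReal_cells _ hc _).le.trans ?_
    refine (measureReal_mono (fun w hw => ?_) (measure_ne_top _ _)).trans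
      (uniformSphere_abs_inner_le hn (pt i) (hpt i))
    -- Replacing the representative by a point `w` of its cell costs at most 1/10 in the inner
    -- product, hence the threshold 2/5 for caps.
    have hw2 : 1 / 2 < |inner ℝ (pt i : Space n) (pt (cell w))| :=
      (Finset.mem_filter.1 (Finset.mem_coe.1 hw)).2
    have h4 : |inner ℝ ((w : Space n) - pt (cell w)) (pt i : Space n)| ≤ 1 / 10 := by
      refine (abs_real_inner_le_norm _ _).trans ?_
      rw [hpt, mul_one]
      exact hd w
    rw [inner_sub_left] at h4
    rw [real_inner_comm] at hw2
    have h5 := abs_sub_abs_le_abs_sub (inner ℝ (pt (cell w) : Space n) (pt i : Space n))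
      (inner ℝ (w : Space n) (pt i : Space n))
    rw [abs_sub_comm] at h5
    simp only [Set.mem_ofPred_eq]
    linarith
  have h6 : (9 / 10 * τ) ^ 2 * P ^ 2 ≤
      P * (τ ^ 2 / 16 * P + (3 / (2 * β)) ^ 2 * (2 * R)) := by
    refine h1.trans ?_
    rw [hP, Finset.sum_mul]
    exact Finset.sum_le_sum fun i hi => mul_le_mul_of_nonneg_left (h2 i hi) (hp0 i)
  rcases hP0.eq_or_lt with h0 | h0
  · rw [← h0]; positivity
  have h7 : (9 / 10 * τ) ^ 2 * P ≤ τ ^ 2 / 16 * P + (3 / (2 * β)) ^ 2 * (2 * R) := by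
    refine le_of_mul_le_mul_left ?_ h0
    linarith
  rw [div_mul_eq_mul_div, le_div_iff₀ (by positivity)]
  have h8 : (3 / (2 * β)) ^ 2 * (2 * R) * β ^ 2 = 9 / 2 * R := by field_simp; ring
  -- This gives `Pτ²β² ≤ 6.03R`, and `γ² ≥ 2` leaves room for the stated `4γ²R`.
  have h9 : τ ^ 2 * P * (81 / 100 - 1 / 16) * β ^ 2 ≤ 9 / 2 * R := by
    rw [← h8]
    refine mul_le_mul_of_nonneg_right ?_ (by positivity)
    linarith
  have h10 : 8 * R ≤ 4 * γ ^ 2 * R := mul_le_mul_of_nonneg_right (by linarith) hR0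
  have h11 : 0 ≤ P * (τ ^ 2 * β ^ 2) := by positivity
  nlinarith

end SecondMoment

/-! ### Runs of algorithms and the union bound. -/

section Algorithm

variable {X : Type*} [MeasurableSpace X]

/-- The queries that the algorithm asks when they are answered by `v`. -/
def SQAlg.queries (v : Oracle X) : SQAlg X → List (Query X)
  | .output _ => []
  | .ask f next => f :: (next (v f)).queries v

theorem SQAlg.length_queries (v : Oracle X) (a : SQAlg X) :
    (a.queries v).length = a.numQueries v := by
  induction a with
  | output b => rfl
  | ask f next ih => simp [SQAlg.queries, SQAlg.numQueries, ih]

theorem SQAlg.run_congr {v v' : Oracle X} (a : SQAlg X) (h : ∀ f ∈ a.queries v, v' f = v f) :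
    a.run v' = a.run v := by
  induction a with
  | output b => rfl
  | ask f next ih =>
    simp only [SQAlg.queries, List.mem_cons, forall_eq_or_imp] at h
    simp only [SQAlg.run]
    rw [h.1]
    exact ih _ h.2

/-- Lower integrals are superadditive, so no measurability is required. -/
theorem sum_lintegral_le {Ω ι : Type*} [MeasurableSpace Ω] (μ : Measure Ω) (s : Finset ι)
    (F : ι → Ω → ENNReal) : ∑ i ∈ s, ∫⁻ ω, F i ω ∂μ ≤ ∫⁻ ω, ∑ i ∈ s, F i ω ∂μ := by
  classical
  induction s using Finset.induction_on with
  | empty => simp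
  | insert i s hi ih =>
    simp only [Finset.sum_insert hi]
    exact (add_le_add_right ih _).trans (le_lintegral_add _ _)

theorem lintegral_comp_cell {Y : Type*} [MeasurableSpace Y] (σ : Measure Y) {cell : Y → ℕ}
    (hc : Measurable cell) {N : ℕ} (hN : ∀ w, cell w < N) (G : ℕ → ENNReal) :
    ∫⁻ w, G (cell w) ∂σ = ∑ i ∈ Finset.range N, σ (cell ⁻¹' {i}) * G i := by
  rw [← lintegral_map (f := G) (g := cell) measurable_from_nat hc, lintegral_countable',
    tsum_eq_sum (s := Finset.range N)]
  · refine Finset.sum_congr rfl fun i _ => ?_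
    rw [Measure.map_apply hc (measurableSet_singleton i), mul_comm]
  · intro i hi
    rw [Measure.map_apply hc (measurableSet_singleton i)]
    have : cell ⁻¹' {i} = ∅ := by
      ext w
      have := hN w
      simp only [Finset.mem_range, not_lt] at hi
      simp only [Set.mem_preimage, Set.mem_singleton_iff, Set.mem_empty_iff_false, iff_false]
      omega
    simp [this]

open Classical in
theorem sum_exists_mem_le {Q : Type*} (s : Finset ℕ) (p : ℕ → ENNReal) (bad : Q → ℕ → Prop)
    {B : ENNReal} (hB : ∀ f, ∑ i ∈ s with bad f i, p i ≤ B) (L : List Q) :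
    ∑ i ∈ s, p i * (if ∃ f ∈ L, bad f i then 1 else 0) ≤ L.length * B := by
  induction L with
  | nil => simp
  | cons f L ih =>
    have h : ∀ i ∈ s, p i * (if ∃ g ∈ f :: L, bad g i then 1 else 0) ≤
        (if bad f i then p i else 0) + p i * (if ∃ g ∈ L, bad g i then 1 else 0) := by
      intro i _
      by_cases h1 : bad f i <;> by_cases h2 : ∃ g ∈ L, bad g i <;> simp [h1, h2]
    refine (Finset.sum_le_sum h).trans ?_
    rw [Finset.sum_add_distrib, ← Finset.sum_filter, List.length_cons, Nat.cast_add, Nat.cast_one,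
      add_mul, one_mul, add_comm]
    exact add_le_add ih (hB f)

-- For fixed coins, either no query of the run with `v₀` is bad for the cell of `w`, so both runs
-- give the same verdict and exactly one of them is right, or a bad query occurs and at most one
-- more is right. The union bound is taken over the queries of the `v₀` run only, so the query bound
-- is needed only for `v₀`.
open Classical in
theorem verdictProb_add_lintegral_le {Y Ω : Type*} [MeasurableSpace Y] (σ : Measure Y)
    [IsProbabilityMeasure σ] [MeasurableSpace Ω] (μ : Measure Ω) [IsProbabilityMeasure μ]
    (A : Ω → SQAlg X) {cell : Y → ℕ} (hc : Measurable cell) {N : ℕ} (hN : ∀ w, cell w < N)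
    (bad : Query X → ℕ → Prop) (v₀ : Oracle X) (v : Y → Oracle X)
    (hv : ∀ w f, ¬ bad f (cell w) → v w f = v₀ f) {q : ℕ} (hq : ∀ ω, (A ω).numQueries v₀ ≤ q)
    {B : ENNReal} (hB : ∀ f, ∑ i ∈ Finset.range N with bad f i, σ (cell ⁻¹' {i}) ≤ B) :
    verdictProb μ A v₀ false + ∫⁻ w, verdictProb μ A (v w) true ∂σ ≤ 1 + q * B := by
  set F : ℕ → Ω → ENNReal := fun i ω =>
    if ∃ f ∈ (A ω).queries v₀, bad f i then 1 else 0 with hF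
  have h1 : ∀ w, verdictProb μ A v₀ false + verdictProb μ A (v w) true ≤
      1 + ∫⁻ ω, F (cell w) ω ∂μ := by
    intro w
    refine (le_lintegral_add _ _).trans ?_
    calc _ ≤ ∫⁻ ω, 1 + F (cell w) ω ∂μ := lintegral_mono fun ω => ?_
      _ = 1 + ∫⁻ ω, F (cell w) ω ∂μ := by rw [lintegral_add_left measurable_const]; simp
    simp only [hF, Set.indicator_apply, Set.mem_ofPred_eq, Pi.one_apply]
    by_cases h : ∃ f ∈ (A ω).queries v₀, bad f (cell w)
    · rw [if_pos h]
      gcongr <;> split_ifs <;> simp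
    · rw [if_neg h]
      push Not at h
      rw [(A ω).run_congr fun f hf => hv w f (h f hf)]
      cases (A ω).run v₀ <;> simp
  calc verdictProb μ A v₀ false + ∫⁻ w, verdictProb μ A (v w) true ∂σ
      = ∫⁻ w, verdictProb μ A v₀ false + verdictProb μ A (v w) true ∂σ := by
        rw [lintegral_add_left measurable_const]; simp
    _ ≤ ∫⁻ w, 1 + ∫⁻ ω, F (cell w) ω ∂μ ∂σ := lintegral_mono h1
    _ = 1 + ∫⁻ w, ∫⁻ ω, F (cell w) ω ∂μ ∂σ := by
        rw [lintegral_add_left measurable_const]; simp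
    _ ≤ 1 + q * B := by
      gcongr
      rw [lintegral_comp_cell σ hc hN (fun i => ∫⁻ ω, F i ω ∂μ)]
      -- The exchange of coins and directions: over finitely many cells it uses only inequalities
      -- valid for nonmeasurable integrands.
      calc _ ≤ ∑ i ∈ Finset.range N, ∫⁻ ω, σ (cell ⁻¹' {i}) * F i ω ∂μ :=
            Finset.sum_le_sum fun i _ => lintegral_const_mul_le _ _
        _ ≤ ∫⁻ ω, ∑ i ∈ Finset.range N, σ (cell ⁻¹' {i}) * F i ω ∂μ := sum_lintegral_le _ _ _
        _ ≤ ∫⁻ _, q * B ∂μ := lintegral_mono fun ω => ?_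
        _ = q * B := by simp
      refine (sum_exists_mem_le _ _ bad hB _).trans ?_
      gcongr
      rw [SQAlg.length_queries]
      exact hq ω

end Algorithm

/-! ### The adversarial oracles and the lower bound. -/

theorem two_mul_sub_one_le {n : ℕ} (hn : 1 ≤ n) {β γ τ η : ℝ} (hβ : 0 < β) (hβ1 : β < 1)
    (hγ : √2 ≤ γ) (hτ : 4 * Real.exp (-Real.pi * γ ^ 2 / 4) ≤ τ)
    {Ω : Type*} [MeasurableSpace Ω] (μ : Measure Ω) [IsProbabilityMeasure μ]
    (A : Ω → SQAlg (Space n)) (q : ℕ) (hq : AsksAtMost A β γ τ q) (hA : SolvesHCLWE μ A β γ τ η) :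
    2 * η - 1 ≤ q * (4 * γ ^ 2 / (τ ^ 2 * β ^ 2) * √0.85 ^ n) := by
  classical
  have := isProbabilityMeasure_uniformSphere hn
  have hτ0 : 0 < τ := lt_of_lt_of_le (by positivity) hτ
  obtain ⟨N, pt, cell, hc, hN, hd, hs⟩ :=
    exists_sphere_cells hn hβ γ (show 0 < 1 / 10 * τ by positivity)
  -- A cell is bad as soon as one of its points is. The Gaussian answer is thus legal throughout
  -- every other cell, and the representative of a bad cell still has shift at least `9τ/10`.
  set bad : Query (Space n) → ℕ → Prop := fun f i => ∃ w, cell w = i ∧ τ < |shift β γ f w|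
    with hbad
  set v₀ : Oracle (Space n) := fun f => ∫ y, f.toFun y ∂(stdGaussian n) with hv₀
  set v : UnitSphere n → Oracle (Space n) := fun w f =>
    if bad f (cell w) then ∫ y, f.toFun y ∂(hclwe (w : Space n) β γ) else v₀ f with hv
  have hv0 : IsSTAT τ (stdGaussian n) v₀ := fun f => by simp [hv₀, hτ0.le]
  have hvw : ∀ w : UnitSphere n, IsSTAT τ (hclwe (w : Space n) β γ) (v w) := by
    intro w f
    by_cases h : bad f (cell w)
    · simp [hv, h, hτ0.le]
    · simp only [hv, h, if_false, hv₀]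
      rw [abs_sub_comm]
      by_contra hlt
      exact h ⟨w, rfl, not_le.1 hlt⟩
  have hB : ∀ f, ∑ i ∈ Finset.range N with bad f i, uniformSphere n (cell ⁻¹' {i}) ≤
      ENNReal.ofReal (4 * γ ^ 2 / (τ ^ 2 * β ^ 2) * √0.85 ^ n) := by
    intro f
    have h := sum_cells_le hn hβ hβ1 hγ hτ pt hc hd f {i ∈ Finset.range N | bad f i} (by
      intro i hi
      obtain ⟨w, rfl, hw⟩ := (Finset.mem_filter.1 hi).2
      have h1 := hs w f
      have h2 := abs_sub_abs_le_abs_sub (shift β γ f w) (shift β γ f (pt (cell w)))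
      linarith)
    refine le_trans (le_of_eq ?_) (ENNReal.ofReal_le_ofReal h)
    rw [ENNReal.ofReal_sum_of_nonneg fun i _ => measureReal_nonneg]
    exact Finset.sum_congr rfl fun i _ => (ofReal_measureReal (measure_ne_top _ _)).symm
  have h1 := verdictProb_add_lintegral_le (uniformSphere n) μ A hc hN bad v₀ v
    (fun w f h => if_neg h) (fun ω => hq ω v₀ (Or.inl hv0)) hB
  set b := 4 * γ ^ 2 / (τ ^ 2 * β ^ 2) * √0.85 ^ n with hb
  have hb0 : 0 ≤ b := by positivity
  have h2 : ENNReal.ofReal η ≤ ENNReal.ofReal ((1 + q * b) / 2) := by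
    refine (hA v₀ v hv0 hvw).trans ((ENNReal.div_le_div_right h1 2).trans (le_of_eq ?_))
    rw [ENNReal.ofReal_div_of_pos two_pos, ENNReal.ofReal_add zero_le_one (by positivity),
      ENNReal.ofReal_mul (Nat.cast_nonneg q), ENNReal.ofReal_natCast, ENNReal.ofReal_one,
      ENNReal.ofReal_ofNat]
  rw [ENNReal.ofReal_le_ofReal_iff (by positivity)] at h2
  linarith

end HCLWE

theorem mainTheorem5 :
    ∃ c : ℝ, 0 < c ∧
      ∀ (n : ℕ), 1 ≤ n →
      ∀ (β γ τ η : ℝ), 0 < β → β < 1 → √2 ≤ γ →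
        4 * Real.exp (-Real.pi * γ ^ 2 / 4) ≤ τ → 1 / 2 < η →
      ∀ (Ω : Type*) [MeasurableSpace Ω] (μ : Measure Ω) [IsProbabilityMeasure μ]
        (A : Ω → HCLWE.SQAlg (HCLWE.Space n)) (q : ℕ),
        HCLWE.AsksAtMost A β γ τ q →
        HCLWE.SolvesHCLWE μ A β γ τ η →
        (2 * η - 1) * Real.exp (c * n) * (τ ^ 2 * β ^ 2 / (4 * γ ^ 2)) ≤ q := by
  have hr0 : (0 : ℝ) < √0.85 := by positivity
  have hr1 : √(0.85 : ℝ) < 1 := by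
    rw [Real.sqrt_lt' one_pos]; norm_num
  -- Chosen so that `exp(cn)` is the inverse of the cap bound `√0.85 ^ n`.
  refine ⟨-Real.log √0.85, neg_pos.2 (Real.log_neg hr0 hr1), ?_⟩
  intro n hn β γ τ η hβ hβ1 hγ hτ _ Ω _ μ _ A q hq hA
  have h := HCLWE.two_mul_sub_one_le hn hβ hβ1 hγ hτ μ A q hq hA
  have hγ0 : 0 < γ := lt_of_lt_of_le (by positivity) hγ
  have hτ0 : 0 < τ := lt_of_lt_of_le (by positivity) hτ
  have he : Real.exp (-Real.log √0.85 * n) = (√0.85 ^ n)⁻¹ := by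
    rw [neg_mul, Real.exp_neg, mul_comm, Real.exp_nat_mul, Real.exp_log hr0]
  rw [he]
  have hR : (0 : ℝ) < √0.85 ^ n := by positivity
  set R := (√0.85 : ℝ) ^ n
  calc (2 * η - 1) * R⁻¹ * (τ ^ 2 * β ^ 2 / (4 * γ ^ 2))
      ≤ ((q : ℝ) * (4 * γ ^ 2 / (τ ^ 2 * β ^ 2) * R)) * R⁻¹ * (τ ^ 2 * β ^ 2 / (4 * γ ^ 2)) := by
        gcongr
    _ = (q : ℝ) := by field_simp
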